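/- A digit space $(X,D)$ is a nonempty, bounded, complete metric space $(X,\mu)$ with a finite set $D$ of contractions of $X$ (the digits) such that $\bigcup_{d\in D}d[X]=X$. A finite sequence $\vec d=[d_0,\dots,d_{n-1}]\in D^n$ also denotes the map $d_0\circ\cdots\circ d_{n-1}$. A digital tree is a set $T\subseteq D^{<\omega}$ that contains the empty sequence, is closed under prefixes and has no maximal element; its value is $[\![T]\!]=\bigcap_{n\in\mathbb N}\bigcup\{\vec d[X]\mid \vec d\in D^n\cap T\}$. A tree is computable if membership in it is decidable. Let $\mathrm K(X)$ be the set of nonempty compact subsets of $X$, with the Hausdorff metric $\mu_{\mathrm H}$. Let $Q=\{u_0,u_1,\dots\}\subseteq X$ be dense; procedures read and return elements of $Q$ through their indices. $(X,D,Q)$ is a computable digit space if $\{(u,v,r)\in Q\times Q\times\mathbb Q\mid \mu(u,v)<r\}$ and $\{(u,v,r)\in Q\times Q\times\mathbb Q\mid \mu(u,v)>r\}$ are computably enumerable and every $d\in D$ is computable, that is, has a computable modulus of uniform continuity and admits a procedure that for $u\in Q$ and $n\in\mathbb N$ computes $v\in Q$ with $\mu(d(u),v)<2^{-n}$. It is -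 well-covering if every $x\in X$ lies in the interior of $d[X]$ for some $d\in D$; - decidable if, for $u\in Q$, $\theta\in\mathbb Q_+$ and $d\in D$, it can be decided whether the open ball of radius $\theta$ about $u$ is contained in $d[X]$. It has approximable choice if for every $d\in D$ there is an effective procedure which for $\theta\in\mathbb Q_+$ and $u\in d[X]\cap Q$ computes $v_u^\theta\in Q$ such that for all $\theta\in\mathbb Q_+$: 1. $\mu(v_u^{\theta},v_u^{\bar\theta})<\max\{\theta,\bar\theta\}$ for all $u\in d[X]\cap Q$ and $\bar\theta\in\mathbb Q_+$; 2. one can compute $\theta'\in\mathbb Q_+$ from $\theta$ such that for all $u,u'\in d[X]\cap Q$, $\mu(u,u')<\theta'$ implies $\mu(v_u^\theta,v_{u'}^\theta)<\theta$; 3. for every $u\in d[X]\cap Q$ there is $z\in X$ with $d(z)=u$ and $\mu(z,v_u^\theta)<\theta$. **Theorem.** Let $(X,D,Q)$ be a well-covering and decidable computable digit space with approximable choice. Then $$\{K\in\mathrm K(X)\mid K=[\![T]\!]\text{ for some computable digital tree }T\}=\{K\in\mathrm K(X)\mid \text{there is a procedure that, given }n\in\mathbb N,\text{ computes a nonempty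 finite }U\subseteq Q\text{ with }\mu_{\mathrm H}(K,U)<2^{-n}\}.$$ -/

import Mathlib

open Set TopologicalSpace

noncomputable section

namespace DigitSpaces

/-! ### Codes of rational numbers -/

/-- The canonical numbering of `ℚ`: the triple `(a, b, c)` names `(a - b) / (c + 1)`. -/
def ratOfCode (c : ℕ × ℕ × ℕ) : ℚ := ((c.1 : ℚ) - c.2.1) / (c.2.2 + 1)

/-- The canonical numbering of the positive rationals: `(p, q)` names `(p + 1) / (q + 1)`. -/
def posRatOfCode (c : ℕ × ℕ) : ℚ := ((c.1 : ℚ) + 1) / (c.2 + 1)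

theorem posRatOfCode_pos (c : ℕ × ℕ) : 0 < posRatOfCode c := by
  unfold posRatOfCode
  positivity

theorem ratOfCode_surjective : Function.Surjective ratOfCode := by
  intro r
  have hd : ((r.den - 1 : ℕ) : ℚ) + 1 = r.den := by
    have : r.den - 1 + 1 = r.den := Nat.succ_pred_eq_of_pos r.den_pos
    exact_mod_cast this
  have hn : ((r.num.toNat : ℕ) : ℚ) - ((-r.num).toNat : ℕ) = r.num := by
    have : (r.num.toNat : ℤ) - ((-r.num).toNat : ℤ) = r.num := by omega
    exact_mod_cast this
  refine ⟨(r.num.toNat, (-r.num).toNat, r.den - 1), ?_⟩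
  simp only [ratOfCode]
  rw [hd, hn]
  exact Rat.num_div_den r

theorem exists_posRatOfCode_eq (r : ℚ) (hr : 0 < r) : ∃ c, posRatOfCode c = r := by
  have hd : ((r.den - 1 : ℕ) : ℚ) + 1 = r.den := by
    have : r.den - 1 + 1 = r.den := Nat.succ_pred_eq_of_pos r.den_pos
    exact_mod_cast this
  have hpos : 0 < r.num := Rat.num_pos.mpr hr
  have hn : (((r.num.toNat - 1 : ℕ) : ℚ)) + 1 = r.num := by
    have : ((r.num.toNat - 1 : ℕ) : ℤ) + 1 = r.num := by omega
    exact_mod_cast this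
  refine ⟨(r.num.toNat - 1, r.den - 1), ?_⟩
  simp only [posRatOfCode]
  rw [hd, hn]
  exact Rat.num_div_den r

variable {X : Type*} [MetricSpace X] {k : ℕ}

/-! ### Digit spaces -/

/-- `(X, D)` is a digit space: `X` is a nonempty bounded complete metric space and
`D` is a finite set of contractions covering `X`. The digits are named by the letters
`d : Fin k`; the set of digits is `Set.range D`. -/
structure IsDigitSpace (D : Fin k → X → X) : Prop where
  nonempty : Nonempty X
  bounded : BoundedSpace X
  complete : CompleteSpace X
  contraction : ∀ d, ∃ q, ContractingWith q (D d)
  covering : ⋃ d, range (D d) = univ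

/-- The composition `d₀ ∘ ⋯ ∘ dₙ₋₁` denoted by a finite sequence of digits. -/
def comp (D : Fin k → X → X) (l : List (Fin k)) : X → X :=
  l.foldr (fun d f => D d ∘ f) id

/-- Every point of `X` lies in the interior of `d[X]` for some digit `d`. -/
def IsWellCovering (D : Fin k → X → X) : Prop :=
  ∀ x, ∃ d, x ∈ interior (range (D d))

/-! ### Digital trees and their values -/

/-- A digital tree: a set of finite digit sequences that contains the empty sequence, is
closed under prefixes and has no maximal element. -/
structure IsDigitalTree (T : Set (List (Fin k))) : Prop where
  nil_mem : [] ∈ T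
  prefix_mem : ∀ l d, l ++ [d] ∈ T → l ∈ T
  exists_extension : ∀ l ∈ T, ∃ d, l ++ [d] ∈ T

/-- The map `x ↦ { d⃗(x) | d⃗ ∈ Dⁿ ∩ T }` from points to sets of points. -/
def treeMap (D : Fin k → X → X) (T : Set (List (Fin k))) (n : ℕ) (x : X) : Set X :=
  {y | ∃ l ∈ T, l.length = n ∧ comp D l x = y}

/-- The value of a tree: the intersection over `n` of the images `f_{T,n}[X]`. -/
def treeValue (D : Fin k → X → X) (T : Set (List (Fin k))) : Set X :=
  ⋂ n, ⋃ x, treeMap D T n x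

/-- The nonempty compact sets that are values of computable (that is, decidable)
digital trees. -/
def computableCompacts (D : Fin k → X → X) : Set (NonemptyCompacts X) :=
  {K | ∃ T : Set (List (Fin k)),
    IsDigitalTree T ∧ ComputablePred (fun l => l ∈ T) ∧ treeValue D T = (K : Set X)}

/-! ### Computable metric spaces and computable digit spaces

The set `Q = {u₀, u₁, …}` of basic elements is given by its enumeration `u : ℕ → X`, in which
repetitions are allowed. A procedure that reads or returns basic elements reads or
returns their indices. -/

/-- `(X, μ, Q)` is a computable metric space with dense set `Q = {u₀, u₁, …}`. -/
structure IsComputableMetric (u : ℕ → X) : Prop where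
  dense : DenseRange u
  lt_re : REPred fun p : ℕ × ℕ × (ℕ × ℕ × ℕ) => dist (u p.1) (u p.2.1) < ratOfCode p.2.2
  gt_re : REPred fun p : ℕ × ℕ × (ℕ × ℕ × ℕ) => (ratOfCode p.2.2 : ℝ) < dist (u p.1) (u p.2.1)

/-- A computable self-map of `(X, μ, Q)`: it is uniformly continuous with a computable
modulus of continuity, and values at basic elements can be approximated effectively by
basic elements. -/
structure IsComputableMap (u : ℕ → X) (Φ : X → X) : Prop where
  modulus : ∃ m : ℕ → ℕ, Computable m ∧
    ∀ n x y, dist x y < (1 / 2 : ℝ) ^ m n → dist (Φ x) (Φ y) < (1 / 2 : ℝ) ^ n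
  approx : ∃ g : ℕ × ℕ → ℕ, Computable g ∧
    ∀ i n, dist (Φ (u i)) (u (g (i, n))) < (1 / 2 : ℝ) ^ n

/-- `(X, D, Q)` is a computable digit space. -/
structure IsComputableDigitSpace (D : Fin k → X → X) (u : ℕ → X) : Prop where
  digitSpace : IsDigitSpace D
  computableMetric : IsComputableMetric u
  computableDigit : ∀ d, IsComputableMap u (D d)

/-- `(X, D, Q)` is decidable: for basic elements `u`, positive rationals `θ` and digits `d` it
can be decided whether the open ball `B(u, θ)` is contained in `d[X]`. -/
def IsDecidable (D : Fin k → X → X) (u : ℕ → X) : Prop :=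
  ComputablePred fun p : ℕ × (ℕ × ℕ) × Fin k =>
    Metric.ball (u p.1) (posRatOfCode p.2.1 : ℝ) ⊆ range (D p.2.2)

/-- `(X, D, Q)` has approximable choice. For each digit `d`, the element `v_u^θ`, for `u = u i`
and `θ` coded by `c`, is the basic element with index `v c i`. The procedure `f` computing it
is partial, since it is required to terminate only for `u ∈ d[X] ∩ Q`. -/
def HasApproximableChoice (D : Fin k → X → X) (u : ℕ → X) : Prop :=
  ∀ d : Fin k, ∃ v : ℕ × ℕ → ℕ → ℕ,
    (∃ f : (ℕ × ℕ) × ℕ →. ℕ, Partrec f ∧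
      ∀ c i, u i ∈ range (D d) → v c i ∈ f (c, i)) ∧
    (∀ c c' i, u i ∈ range (D d) →
      dist (u (v c i)) (u (v c' i)) < max (posRatOfCode c : ℝ) (posRatOfCode c')) ∧
    (∃ g : ℕ × ℕ → ℕ × ℕ, Computable g ∧
      ∀ c i j, u i ∈ range (D d) → u j ∈ range (D d) →
        dist (u i) (u j) < posRatOfCode (g c) →
        dist (u (v c i)) (u (v c j)) < posRatOfCode c) ∧
    (∀ c i, u i ∈ range (D d) →
      ∃ z, D d z = u i ∧ dist z (u (v c i)) < posRatOfCode c)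

/-- The nonempty compact sets that are computable in the sense of Type-Two Theory of
Effectivity: some procedure computes from `n` a basic set, that is, a nonempty finite set of
basic elements (given as a list of indices), at Hausdorff distance less than `2⁻ⁿ`. -/
def tteComputableCompacts (u : ℕ → X) : Set (NonemptyCompacts X) :=
  {K | ∃ U : ℕ → List ℕ, Computable U ∧
    ∀ n, U n ≠ [] ∧
      Metric.hausdorffDist (K : Set X) (u '' {i | i ∈ U n}) < (1 / 2 : ℝ) ^ n}

end DigitSpaces

end

open Set TopologicalSpace
open scoped NNReal

namespace DigitSpaces

/-! ### Computability on lists and finite types -/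

/-! From trees to approximations: the images `comp D l` shrink at a computable rate in the length of
`l`, so the words of `T` of one suitable length yield finitely many small pieces covering the value.
Each piece also meets the value: since `T` has no maximal element, compactness produces a point
along a path through any node (`IsDigitalTree.exists_mem_treeValue`). One rounded point per piece is
thus close to `K` in the Hausdorff metric.

From approximations to trees: approximable choice converges to a right inverse `s d` of each digit
on the interior of its range (`exists_right_inverse`), and `exists_computable_selection` makes it
computable. Iterating `s` expands a point of `K` into digits, where `d` is allowed at `z` if a ball
of fixed radius about `z` lies in `d[X]`. Well-covering and a Lebesgue number ensure that some digit
is always allowed. Whether a word expands some point of `K` need not be decidable exactly, since `K`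
and `s` are known only approximately. The remedy is a test with slack: at length `n` it accepts
every expansion of radius `a n` and accepts only expansions of radius `a (n + 1)`, for decreasing
radii bounded away from zero. What acceptance guarantees at one length is then what suffices at the
next, so an accepted word can be extended (`mem_computableCompacts_of_test`). -/

theorem computable_list_foldl {α β σ : Type*} [Primcodable α] [Primcodable β] [Primcodable σ]
    {f : α → List β} {g : α → σ} {h : α → σ → β → σ} (hf : Computable f) (hg : Computable g)
    (hh : Computable fun p : α × σ × β => h p.1 p.2.1 p.2.2) :
    Computable fun a => (f a).foldl (h a) (g a) := by
  have hstep : Computable₂ fun (a : α) (p : ℕ × σ) =>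
      (Option.casesOn (f a)[p.1]? p.2 fun b => h a p.2 b : σ) := by
    refine Computable.option_casesOn (o := fun q : α × ℕ × σ => (f q.1)[q.2.1]?)
      (f := fun q => q.2.2) (g := fun q b => h q.1 q.2.2 b) ?_ ?_ ?_
    · exact Computable.list_getElem?.comp (hf.comp .fst) (Computable.fst.comp .snd)
    · exact Computable.snd.comp .snd
    · exact hh.comp (Computable.pair (Computable.fst.comp .fst)
        (Computable.pair ((Computable.snd.comp .snd).comp .fst) .snd))
  refine (Computable.nat_rec (Computable.list_length.comp hf) hg hstep).of_eq fun a => ?_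
  -- Invariant: after `n` rounds of recursion on the position, the state is the fold over the first
  -- `n` entries.
  have key : ∀ n, Nat.rec (motive := fun _ => σ) (g a)
      (fun n s => (Option.casesOn (f a)[n]? s fun b => h a s b : σ)) n
      = ((f a).take n).foldl (h a) (g a) := by
    intro n
    induction n with
    | zero => simp
    | succ n ih =>
      simp only [ih, List.take_add_one, List.foldl_append]
      cases (f a)[n]? <;> simp
  exact (key _).trans (by rw [List.take_length])

theorem computable_list_foldr {α β σ : Type*} [Primcodable α] [Primcodable β] [Primcodable σ]
    {f : α → List β} {g : α → σ} {h : α → β → σ → σ} (hf : Computable f) (hg : Computable g)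
    (hh : Computable fun p : α × σ × β => h p.1 p.2.2 p.2.1) :
    Computable fun a => (f a).foldr (h a) (g a) :=
  (computable_list_foldl (h := fun a s b => h a b s) (Computable.list_reverse.comp hf) hg hh).of_eq
    fun a => by simp

theorem computable_list_any {α β : Type*} [Primcodable α] [Primcodable β]
    {f : α → List β} {p : α → β → Bool} (hf : Computable f) (hp : Computable₂ p) :
    Computable fun a => (f a).any (p a) := by
  refine (computable_list_foldl (h := fun a s b => s || p a b) hf (Computable.const false)
    ?_).of_eq fun a => ?_
  · exact Primrec.or.to_comp.comp (Computable.fst.comp .snd)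
      (hp.comp .fst (Computable.snd.comp .snd))
  · generalize f a = l
    induction l using List.reverseRecOn with
    | nil => rfl
    | append_singleton l b ih => simp [List.foldl_append, ih]

theorem computable_list_filter {α β : Type*} [Primcodable α] [Primcodable β]
    {f : α → List β} {p : β → Bool} (hf : Computable f) (hp : Computable p) :
    Computable fun a => (f a).filter p := by
  refine (computable_list_foldl (h := fun _ s b => cond (p b) (s ++ [b]) s) hf
    (Computable.const []) ?_).of_eq fun a => ?_
  · exact Computable.cond (hp.comp (Computable.snd.comp .snd))
      (Computable.list_concat.comp (Computable.fst.comp .snd) (Computable.snd.comp .snd))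
      (Computable.fst.comp .snd)
  · generalize f a = l
    induction l using List.reverseRecOn with
    | nil => rfl
    | append_singleton l b ih => cases hb : p b <;> simp [List.foldl_append, ih, hb]

theorem computable_list_map {α β γ : Type*} [Primcodable α] [Primcodable β] [Primcodable γ]
    {f : α → List β} {g : α → β → γ} (hf : Computable f) (hg : Computable₂ g) :
    Computable fun a => (f a).map (g a) := by
  refine (computable_list_foldl (h := fun a s b => s ++ [g a b]) hf
    (Computable.const []) ?_).of_eq fun a => ?_
  · exact Computable.list_concat.comp (Computable.fst.comp .snd)
      (hg.comp .fst (Computable.snd.comp .snd))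
  · generalize f a = l
    induction l using List.reverseRecOn with
    | nil => rfl
    | append_singleton l b ih => simp [List.foldl_append, ih]

/-- Procedures given separately for each digit become one procedure by a finite case distinction; no
uniformity in the digit is assumed. -/
theorem partrec_of_fin {k : ℕ} {α σ : Type*} [Primcodable α] [Primcodable σ]
    {f : Fin k → α →. σ} (hf : ∀ d, Partrec (f d)) :
    Partrec fun p : Fin k × α => f p.1 p.2 := by
  have key : ∀ n, ∃ F : Fin k × α →. σ, Partrec F ∧
      ∀ d : Fin k, d.val < n → ∀ a, F (d, a) = f d a := by
    intro n
    induction n with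
    | zero => exact ⟨_, Partrec.none, by simp⟩
    | succ n ih =>
      obtain ⟨F, hF, hFf⟩ := ih
      by_cases hn : n < k
      · refine ⟨fun p => cond (decide (p.1.val = n)) (f ⟨n, hn⟩ p.2) (F p),
          Partrec.cond ?_ ((hf ⟨n, hn⟩).comp .snd) hF, fun d hd a => ?_⟩
        · exact ((Primrec.eq (α := ℕ)).comp (Primrec.fin_val.comp .fst)
            (Primrec.const n)).decide.to_comp
        · by_cases hdn : d.val = n
          · obtain rfl : d = ⟨n, hn⟩ := Fin.ext hdn
            simp
          · simp [hdn, hFf d (by omega)]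
      · exact ⟨F, hF, fun d hd a => hFf d (by omega) a⟩
  obtain ⟨F, hF, hFf⟩ := key k
  exact hF.of_eq fun p => hFf p.1 p.1.2 p.2

theorem computable_of_fin {k : ℕ} {α σ : Type*} [Primcodable α] [Primcodable σ]
    {f : Fin k → α → σ} (hf : ∀ d, Computable (f d)) :
    Computable fun p : Fin k × α => f p.1 p.2 :=
  partrec_of_fin (f := fun d => (f d : α →. σ)) hf

theorem computable_pow_two : Computable fun n : ℕ => 2 ^ n := by
  refine (Primrec.nat_rec₁ 1 (f := fun _ m => 2 * m) ?_).to_comp.of_eq fun n => ?_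
  · exact Primrec.nat_mul.comp (Primrec.const 2) Primrec.snd
  · induction n with
    | zero => rfl
    | succ n ih => exact (congrArg (2 * ·) ih).trans (pow_succ' 2 n).symm

theorem computable_iterate {f : ℕ → ℕ} (hf : Computable f) : Computable₂ fun n m => f^[n] m := by
  refine (Computable.nat_rec (f := fun p : ℕ × ℕ => p.1) (g := fun p => p.2)
    (h := fun _ q => f q.2) Computable.fst Computable.snd
    (hf.comp (Computable.snd.comp .snd))).of_eq fun ⟨n, m⟩ => ?_
  induction n with
  | zero => rfl
  | succ n ih => exact (congrArg f ih).trans (Function.iterate_succ_apply' f n m).symm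

theorem exists_computable_max {k : ℕ} {f : Fin k → ℕ → ℕ} (hf : ∀ d, Computable (f d)) :
    ∃ g : ℕ → ℕ, Computable g ∧ (∀ n, n ≤ g n) ∧ ∀ d n, f d n ≤ g n := by
  refine ⟨fun n => (List.finRange k).foldl (fun s d => max s (f d n)) n, ?_, ?_⟩
  · refine computable_list_foldl (h := fun n s d => max s (f d n)) (Computable.const _)
      Computable.id ?_
    exact Primrec.nat_max.to_comp.comp (Computable.fst.comp .snd)
      ((computable_of_fin hf).comp (Computable.pair (Computable.snd.comp .snd) .fst))
  · have key : ∀ (l : List (Fin k)) (n : ℕ), n ≤ l.foldl (fun s d => max s (f d n)) n ∧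
        ∀ d ∈ l, f d n ≤ l.foldl (fun s d => max s (f d n)) n := by
      intro l n
      induction l using List.reverseRecOn with
      | nil => simp
      | append_singleton l b ih =>
        simp only [List.foldl_append, List.foldl_cons, List.foldl_nil, List.mem_append,
          List.mem_singleton]
        refine ⟨le_max_of_le_left ih.1, ?_⟩
        rintro d (hd | rfl)
        · exact le_max_of_le_left (ih.2 d hd)
        · exact le_max_right _ _
    exact ⟨fun n => (key _ n).1, fun d n => (key _ n).2 d (List.mem_finRange d)⟩

/-- The list of all words of length `n` over `Fin k`. -/
def words (k : ℕ) (n : ℕ) : List (List (Fin k)) :=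
  Nat.rec [[]] (fun _ L => L.flatMap fun l => (List.finRange k).map fun d => l ++ [d]) n

theorem mem_words {k n : ℕ} {l : List (Fin k)} : l ∈ words k n ↔ l.length = n := by
  induction n generalizing l with
  | zero => simp [words]
  | succ n ih =>
    have : words k (n + 1)
        = (words k n).flatMap fun l => (List.finRange k).map fun d => l ++ [d] := rfl
    rw [this]
    simp only [List.mem_flatMap, ih, List.mem_map, List.mem_finRange, true_and]
    constructor
    · rintro ⟨l, rfl, d, rfl⟩
      simp
    · intro h
      rcases List.eq_nil_or_concat l with rfl | ⟨l', d, rfl⟩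
      · simp at h
      · exact ⟨l', by simpa using h, d, by simp⟩

theorem computable_words (k : ℕ) : Computable (words k) := by
  refine (Primrec.nat_rec₁ _ ?_).to_comp
  refine Primrec.list_flatMap Primrec.snd ?_
  exact Primrec.list_map (Primrec.const _)
    (Primrec.list_concat.comp (Primrec.snd.comp .fst) Primrec.snd)

section

/-! ### Geometry of digit spaces -/

theorem comp_append {X : Type*} {k : ℕ} (D : Fin k → X → X) (l l' : List (Fin k)) (x : X) :
    comp D (l ++ l') x = comp D l (comp D l' x) := by
  induction l with
  | nil => rfl
  | cons d l ih => exact congrArg (D d) ih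

theorem mem_treeValue {X : Type*} {k : ℕ} {D : Fin k → X → X} {T : Set (List (Fin k))} {y : X} :
    y ∈ treeValue D T ↔ ∀ n, ∃ l ∈ T, l.length = n ∧ y ∈ range (comp D l) := by
  simp only [treeValue, treeMap, mem_iInter, mem_iUnion, mem_ofPred_eq, mem_range]
  refine forall_congr' fun n => ⟨?_, ?_⟩
  · rintro ⟨x, l, hl, hn, hx⟩
    exact ⟨l, hl, hn, x, hx⟩
  · rintro ⟨l, hl, hn, x, hx⟩
    exact ⟨x, l, hl, hn, hx⟩

theorem range_comp_append_subset {X : Type*} {k : ℕ} (D : Fin k → X → X) (l l' : List (Fin k)) :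
    range (comp D (l ++ l')) ⊆ range (comp D l) := by
  rintro _ ⟨x, rfl⟩
  exact ⟨comp D l' x, (comp_append D l l' x).symm⟩

theorem IsDigitalTree.mem_of_append_mem {k : ℕ} {T : Set (List (Fin k))} (hT : IsDigitalTree T)
    (l l' : List (Fin k)) (h : l ++ l' ∈ T) : l ∈ T := by
  induction l' using List.reverseRecOn with
  | nil => simpa using h
  | append_singleton l' d ih =>
    exact ih (hT.prefix_mem _ d (by simpa [List.append_assoc] using h))

variable {X : Type*} [MetricSpace X] {k : ℕ} {D : Fin k → X → X}

theorem IsDigitSpace.exists_lipschitz (h : IsDigitSpace D) :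
    ∃ q : ℝ≥0, q < 1 ∧ ∀ d, LipschitzWith q (D d) := by
  choose q hq using h.contraction
  refine ⟨Finset.univ.sup q, ?_, fun d => (hq d).2.weaken (Finset.le_sup (Finset.mem_univ d))⟩
  rw [Finset.sup_lt_iff (by simp)]
  exact fun d _ => (hq d).1

theorem IsDigitSpace.dist_le (h : IsDigitSpace D) (d : Fin k) (x y : X) :
    dist (D d x) (D d y) ≤ dist x y := by
  obtain ⟨q, hq, hl⟩ := h.exists_lipschitz
  exact ((hl d).dist_le_mul x y).trans
    (mul_le_of_le_one_left dist_nonneg (by exact_mod_cast hq.le))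

theorem IsDigitSpace.continuous (h : IsDigitSpace D) (d : Fin k) : Continuous (D d) := by
  obtain ⟨q, -, hl⟩ := h.exists_lipschitz
  exact (hl d).continuous

theorem IsDigitSpace.continuous_comp (h : IsDigitSpace D) (l : List (Fin k)) :
    Continuous (comp D l) := by
  induction l with
  | nil => exact continuous_id
  | cons d l ih => exact (h.continuous d).comp ih

theorem lipschitzWith_comp {q : ℝ≥0} (hq : ∀ d, LipschitzWith q (D d)) (l : List (Fin k)) :
    LipschitzWith (q ^ l.length) (comp D l) := by
  induction l with
  | nil => simpa using! LipschitzWith.id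
  | cons d l ih =>
    rw [List.length_cons, pow_succ']
    exact (hq d).comp ih

theorem IsDigitSpace.exists_mem_range_comp (h : IsDigitSpace D) (n : ℕ) (x : X) :
    ∃ l, l.length = n ∧ x ∈ range (comp D l) := by
  induction n generalizing x with
  | zero => exact ⟨[], rfl, x, rfl⟩
  | succ n ih =>
    obtain ⟨d, z, rfl⟩ : ∃ d, x ∈ range (D d) := by
      rw [← mem_iUnion, h.covering]; trivial
    obtain ⟨l, hl, w, rfl⟩ := ih z
    exact ⟨d :: l, by simp [hl], w, rfl⟩

/-- The images `d⃗[X]` shrink exponentially in the length of `d⃗`. -/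
theorem IsDigitSpace.exists_rate (h : IsDigitSpace D) :
    ∃ c b : ℕ, ∀ (l : List (Fin k)) (n : ℕ) (x y : X), c * (n + b) ≤ l.length →
      dist (comp D l x) (comp D l y) ≤ (1 / 2 : ℝ) ^ n := by
  obtain ⟨q, hq, hl⟩ := h.exists_lipschitz
  have hq' : (q : ℝ) < 1 := by exact_mod_cast hq
  -- Every `c` letters halve the diameter, and `b` absorbs the initial diameter of `X`. The
  -- resulting length `c * (n + b)` is computable in `n`.
  obtain ⟨c, hc⟩ := exists_pow_lt_of_lt_one (show (0 : ℝ) < 1 / 2 by norm_num) hq'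
  have := h.bounded
  obtain ⟨b, hb⟩ := pow_unbounded_of_one_lt (Metric.diam (univ : Set X)) (one_lt_two (α := ℝ))
  refine ⟨c, b, fun l n x y hln => ?_⟩
  have h1 : dist x y ≤ 2 ^ b :=
    (Metric.dist_le_diam_of_mem (Bornology.isBounded_univ.2 this) trivial trivial).trans hb.le
  have h2 : (q : ℝ) ^ l.length ≤ (1 / 2) ^ (n + b) :=
    calc (q : ℝ) ^ l.length ≤ q ^ (c * (n + b)) := pow_le_pow_of_le_one q.2 hq'.le hln
      _ = (q ^ c) ^ (n + b) := pow_mul _ _ _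
      _ ≤ (1 / 2) ^ (n + b) := pow_le_pow_left₀ (pow_nonneg q.2 _) hc.le _
  calc dist (comp D l x) (comp D l y) ≤ q ^ l.length * dist x y := by
        simpa using (lipschitzWith_comp hl l).dist_le_mul x y
    _ ≤ (1 / 2) ^ (n + b) * 2 ^ b := by gcongr
    _ = (1 / 2) ^ n := by rw [pow_add, mul_assoc, ← mul_pow]; norm_num

/-- The images of a single point under all words of a large fixed length form a finite ε-net. -/
theorem IsDigitSpace.compactSpace (h : IsDigitSpace D) : CompactSpace X := by
  have := h.complete
  obtain ⟨x₀⟩ := h.nonempty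
  obtain ⟨c, b, hcb⟩ := h.exists_rate
  refine ⟨TotallyBounded.isCompact_of_isClosed (Metric.totallyBounded_iff.2 fun ε hε => ?_)
    isClosed_univ⟩
  obtain ⟨n, hn⟩ := exists_pow_lt_of_lt_one hε (show (1 / 2 : ℝ) < 1 by norm_num)
  refine ⟨(fun l => comp D l x₀) '' {l | l.length = c * (n + b)},
    (List.finite_length_eq _ _).image _, fun x _ => ?_⟩
  obtain ⟨l, hl, z, rfl⟩ := h.exists_mem_range_comp (c * (n + b)) x
  simp only [mem_iUnion]
  exact ⟨_, ⟨l, hl, rfl⟩, Metric.mem_ball.2 ((hcb l n z x₀ hl.ge).trans_lt hn)⟩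

/-- Every node of a digital tree contains a point of the value of the tree. -/
theorem IsDigitalTree.exists_mem_treeValue {T : Set (List (Fin k))} (hT : IsDigitalTree T)
    (hD : IsDigitSpace D) {l : List (Fin k)} (hl : l ∈ T) :
    ∃ y ∈ treeValue D T, y ∈ range (comp D l) := by
  have := hD.compactSpace
  have := hD.nonempty
  choose e he using hT.exists_extension
  let w : ℕ → T := fun n => Nat.rec ⟨l, hl⟩ (fun _ s => ⟨s.1 ++ [e s.1 s.2], he s.1 s.2⟩) n
  have hw : ∀ n, (w (n + 1)).1 = (w n).1 ++ [e (w n).1 (w n).2] := fun n => rfl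
  have hlen : ∀ n, (w n).1.length = l.length + n := by
    intro n
    induction n with
    | zero => rfl
    | succ n ih => rw [hw]; simp [ih]; omega
  have hcompact : ∀ n, IsCompact (range (comp D (w n).1)) := fun n =>
    isCompact_range (hD.continuous_comp _)
  obtain ⟨y, hy⟩ := IsCompact.nonempty_iInter_of_sequence_nonempty_isCompact_isClosed
    (fun n => range (comp D (w n).1))
    (fun n => by rw [hw]; exact range_comp_append_subset D _ _)
    (fun n => range_nonempty _) (hcompact 0) (fun n => (hcompact n).isClosed)
  rw [mem_iInter] at hy
  refine ⟨y, mem_treeValue.2 fun n => ?_, hy 0⟩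
  -- The path starts at `l`, so `w n` may be longer than `n`; its prefix of length `n` is in `T` and
  -- has a larger image.
  refine ⟨(w n).1.take n, hT.mem_of_append_mem _ ((w n).1.drop n) ?_, ?_, ?_⟩
  · rw [List.take_append_drop]; exact (w n).2
  · rw [List.length_take, hlen]; omega
  · apply range_comp_append_subset D _ ((w n).1.drop n)
    rw [List.take_append_drop]; exact hy n

end

section

variable {X : Type*} [MetricSpace X] {k : ℕ} {D : Fin k → X → X} {u : ℕ → X}

/-! ### Values of computable trees are computable -/

/-- Digits do not increase distances, so the rounding errors merely add up, one per letter. -/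
theorem dist_comp_foldr_le (hD : IsDigitSpace D) {g : Fin k → ℕ × ℕ → ℕ}
    (hg : ∀ d i n, dist (D d (u i)) (u (g d (i, n))) < (1 / 2 : ℝ) ^ n) (m : ℕ)
    (l : List (Fin k)) :
    dist (comp D l (u 0)) (u (l.foldr (fun d i => g d (i, m)) 0)) ≤ l.length * (1 / 2 : ℝ) ^ m := by
  induction l with
  | nil => simp [comp]
  | cons d l ih =>
    set i := l.foldr (fun d i => g d (i, m)) 0 with hi
    calc dist (D d (comp D l (u 0))) (u (g d (i, m)))
        ≤ dist (D d (comp D l (u 0))) (D d (u i)) + dist (D d (u i)) (u (g d (i, m))) :=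
          dist_triangle _ _ _
      _ ≤ l.length * (1 / 2 : ℝ) ^ m + (1 / 2 : ℝ) ^ m :=
          add_le_add ((hD.dist_le d _ _).trans ih) (hg d i m).le
      _ = (d :: l).length * (1 / 2 : ℝ) ^ m := by push_cast [List.length_cons]; ring

theorem natCast_mul_half_pow_le (a n : ℕ) : a * (1 / 2 : ℝ) ^ (n + a) ≤ (1 / 2 : ℝ) ^ n := by
  have h : (a : ℝ) ≤ 2 ^ a := by exact_mod_cast (Nat.lt_two_pow_self (n := a)).le
  calc a * (1 / 2 : ℝ) ^ (n + a) ≤ 2 ^ a * (1 / 2 : ℝ) ^ (n + a) := by gcongr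
    _ = (1 / 2) ^ n := by rw [pow_add, mul_left_comm, ← mul_pow]; norm_num

theorem computableCompacts_subset (hX : IsComputableDigitSpace D u) :
    computableCompacts D ⊆ tteComputableCompacts u := by
  rintro K ⟨T, hT, ⟨_, hTc⟩, hTK⟩
  have hD := hX.digitSpace
  obtain ⟨c, b, hcb⟩ := hD.exists_rate
  choose g hgc hg using fun d => (hX.computableDigit d).approx
  let index : ℕ × List (Fin k) → ℕ := fun p => p.2.foldr (fun d i => g d (i, p.1)) 0
  have hindex : Computable index := by
    refine computable_list_foldr (h := fun p d i => g d (i, p.1)) Computable.snd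
      (Computable.const 0) ?_
    exact (computable_of_fin hgc).comp (Computable.pair (Computable.snd.comp .snd)
      (Computable.pair (Computable.fst.comp .snd) (Computable.fst.comp .fst)))
  let W : ℕ → List (List (Fin k)) := fun n =>
    (words k (c * (n + 2 + b))).filter fun l => decide (l ∈ T)
  have hW : Computable W := by
    refine computable_list_filter ((computable_words k).comp ?_) hTc
    exact (Primrec.nat_mul.comp (Primrec.const c) (Primrec.nat_add.comp
      (Primrec.nat_add.comp Primrec.id (Primrec.const 2)) (Primrec.const b))).to_comp
  have mem_W : ∀ {n l}, l ∈ W n ↔ l.length = c * (n + 2 + b) ∧ l ∈ T := by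
    intro n l
    simp [W, mem_words]
  -- The extra `l.length` bits offset the one rounding error per letter. Diameter and rounding then
  -- contribute `2⁻ⁿ⁻²` each, and the bound `2⁻ⁿ⁻¹` leaves room for the strict inequality.
  let U : ℕ → List ℕ := fun n => (W n).map fun l => index (n + 2 + l.length, l)
  have hU : Computable U := by
    refine computable_list_map hW (hindex.comp (Computable.pair ?_ Computable.snd))
    exact Primrec.nat_add.to_comp.comp
      (Primrec.nat_add.to_comp.comp Computable.fst (Computable.const 2))
      (Computable.list_length.comp Computable.snd)
  have near : ∀ n l, l ∈ W n → ∀ y ∈ range (comp D l),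
      dist y (u (index (n + 2 + l.length, l))) ≤ (1 / 2 : ℝ) ^ (n + 1) := by
    rintro n l hl _ ⟨x, rfl⟩
    calc dist (comp D l x) (u (index (n + 2 + l.length, l)))
        ≤ dist (comp D l x) (comp D l (u 0))
          + dist (comp D l (u 0)) (u (index (n + 2 + l.length, l))) := dist_triangle _ _ _
      _ ≤ (1 / 2 : ℝ) ^ (n + 2) + (1 / 2 : ℝ) ^ (n + 2) :=
          add_le_add (hcb l _ _ _ (mem_W.1 hl).1.ge)
            ((dist_comp_foldr_le hD hg _ l).trans (natCast_mul_half_pow_le _ _))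
      _ = (1 / 2 : ℝ) ^ (n + 1) := by ring
  have cover : ∀ n, ∀ y ∈ (K : Set X), ∃ l ∈ W n, y ∈ range (comp D l) := by
    intro n y hy
    rw [← hTK] at hy
    obtain ⟨l, hl, hn, hy⟩ := mem_treeValue.1 hy (c * (n + 2 + b))
    exact ⟨l, mem_W.2 ⟨hn, hl⟩, hy⟩
  refine ⟨U, hU, fun n => ⟨?_, ?_⟩⟩
  · obtain ⟨y, hy⟩ := K.nonempty
    obtain ⟨l, hl, -⟩ := cover n y hy
    exact List.ne_nil_of_mem (List.mem_map_of_mem hl)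
  · refine (Metric.hausdorffDist_le_of_mem_dist (r := (1 / 2 : ℝ) ^ (n + 1)) (by positivity)
      ?_ ?_).trans_lt (pow_lt_pow_right_of_lt_one₀ (by norm_num) (by norm_num) n.lt_succ_self)
    · intro y hy
      obtain ⟨l, hl, hyl⟩ := cover n y hy
      exact ⟨_, ⟨_, List.mem_map_of_mem hl, rfl⟩, near n l hl y hyl⟩
    · rintro _ ⟨i, hi, rfl⟩
      obtain ⟨l, hl, rfl⟩ := List.mem_map.1 hi
      obtain ⟨y, hy, hyl⟩ := hT.exists_mem_treeValue hD (mem_W.1 hl).2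
      rw [hTK] at hy
      exact ⟨y, hy, (dist_comm _ _).trans_le (near n l hl y hyl)⟩

end

section

variable {X : Type*} [MetricSpace X] {k : ℕ} {D : Fin k → X → X} {u : ℕ → X}

/-! ### Computable selections of preimages -/

/-- The code of `2⁻ᵉ`. -/
def halfPowCode (e : ℕ) : ℕ × ℕ := (0, 2 ^ e - 1)

theorem posRatOfCode_halfPowCode (e : ℕ) : (posRatOfCode (halfPowCode e) : ℝ) = (1 / 2) ^ e := by
  have h : ((2 ^ e - 1 : ℕ) : ℝ) + 1 = 2 ^ e := by
    have : 2 ^ e - 1 + 1 = 2 ^ e := Nat.sub_add_cancel Nat.one_le_two_pow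
    exact_mod_cast this
  simp only [posRatOfCode, halfPowCode]
  push_cast
  rw [h]
  simp

theorem computable_halfPowCode : Computable halfPowCode :=
  Computable.pair (Computable.const 0)
    (Primrec.nat_sub.to_comp.comp computable_pow_two (Computable.const 1))

/-- Lets a modulus given as a coded rational be replaced by a power of `1/2` whose exponent is read
off the code. -/
theorem half_pow_snd_le_posRatOfCode (c : ℕ × ℕ) : (1 / 2 : ℝ) ^ c.2 ≤ posRatOfCode c := by
  have h : (c.2 : ℝ) + 1 ≤ 2 ^ c.2 := by exact_mod_cast Nat.lt_two_pow_self (n := c.2)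
  calc (1 / 2 : ℝ) ^ c.2 = 1 / 2 ^ c.2 := by simp
    _ ≤ 1 / (c.2 + 1) := by gcongr
    _ ≤ (c.1 + 1) / (c.2 + 1) := by gcongr; simp
    _ = posRatOfCode c := by simp [posRatOfCode]

theorem half_pow_add_half_pow (n : ℕ) :
    (1 / 2 : ℝ) ^ (n + 1) + (1 / 2 : ℝ) ^ (n + 1) = (1 / 2) ^ n := by ring

/-- A procedure for approximable choice has a limit, which is a right inverse of the digit on the
interior of its range. -/
theorem exists_right_inverse (hX : IsComputableDigitSpace D u) {d : Fin k} {v : ℕ × ℕ → ℕ → ℕ}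
    {g : ℕ × ℕ → ℕ × ℕ}
    (hlim : ∀ c c' i, u i ∈ range (D d) →
      dist (u (v c i)) (u (v c' i)) < max (posRatOfCode c : ℝ) (posRatOfCode c'))
    (hmod : ∀ c i j, u i ∈ range (D d) → u j ∈ range (D d) →
        dist (u i) (u j) < posRatOfCode (g c) →
        dist (u (v c i)) (u (v c j)) < posRatOfCode c)
    (hinv : ∀ c i, u i ∈ range (D d) → ∃ z, D d z = u i ∧ dist z (u (v c i)) < posRatOfCode c)
    {z : X} (hz : z ∈ interior (range (D d))) :
    ∃ y, D d y = z ∧ ∀ e i, u i ∈ range (D d) →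
      dist z (u i) < (1 / 2) ^ ((g (halfPowCode (e + 2))).2 + 1) →
      dist y (u (v (halfPowCode (e + 2)) i)) < (1 / 2) ^ e := by
  have := hX.digitSpace.complete
  -- The `+ 1` makes two basic elements this close to `z` close enough to each other for the modulus
  -- at `2⁻ᵉ⁻²`.
  set H : ℕ → ℕ := fun e => (g (halfPowCode (e + 2))).2 + 1 with hH
  have hlim' : ∀ e e' i, e ≤ e' → u i ∈ range (D d) →
      dist (u (v (halfPowCode (e + 2)) i)) (u (v (halfPowCode (e' + 2)) i))
        < (1 / 2) ^ (e + 2) := by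
    intro e e' i he hi
    have := hlim (halfPowCode (e + 2)) (halfPowCode (e' + 2)) i hi
    rwa [posRatOfCode_halfPowCode, posRatOfCode_halfPowCode, max_eq_left] at this
    exact pow_le_pow_of_le_one (by norm_num) (by norm_num) (by omega)
  have hmod' : ∀ e i j, u i ∈ range (D d) → u j ∈ range (D d) →
      dist z (u i) < (1 / 2) ^ H e → dist z (u j) < (1 / 2) ^ H e →
      dist (u (v (halfPowCode (e + 2)) i)) (u (v (halfPowCode (e + 2)) j))
        < (1 / 2) ^ (e + 2) := by
    intro e i j hi hj hzi hzj
    rw [← posRatOfCode_halfPowCode]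
    refine hmod _ i j hi hj (lt_of_lt_of_le ?_ (half_pow_snd_le_posRatOfCode _))
    calc dist (u i) (u j) ≤ dist z (u i) + dist z (u j) := dist_triangle_left _ _ _
      _ < (1 / 2) ^ H e + (1 / 2) ^ H e := add_lt_add hzi hzj
      _ = _ := half_pow_add_half_pow _
  have happrox : ∀ m, ∃ i, u i ∈ range (D d) ∧ dist z (u i) < (1 / 2) ^ m ∧
      ∀ e ≤ m, dist z (u i) < (1 / 2) ^ H e := by
    intro m
    obtain ⟨ε, hε, hball⟩ := Metric.isOpen_iff.1 isOpen_interior z hz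
    -- The sum dominates `m` and every `H e` with `e ≤ m`, without monotonicity of `H`.
    set N := m + ∑ e ∈ Finset.range (m + 1), H e
    obtain ⟨i, hi⟩ := hX.computableMetric.dense.exists_dist_lt z
      (lt_min hε (pow_pos (one_half_pos (α := ℝ)) N))
    rw [lt_min_iff] at hi
    refine ⟨i, interior_subset (hball (by rw [Metric.mem_ball, dist_comm]; exact hi.1)),
      hi.2.trans_le (pow_le_pow_of_le_one (by norm_num) (by norm_num) (Nat.le_add_right _ _)),
      fun e he => hi.2.trans_le (pow_le_pow_of_le_one (by norm_num) (by norm_num) ?_)⟩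
    exact (Finset.single_le_sum (f := H) (fun _ _ => Nat.zero_le _)
      (Finset.mem_range.2 (Nat.lt_succ_of_le he))).trans (Nat.le_add_left _ _)
  choose i hir hizm hize using happrox
  set w : ℕ → X := fun m => u (v (halfPowCode (m + 2)) (i m)) with hw
  have hstep : ∀ m n, m ≤ n → dist (w m) (w n) ≤ (1 / 2) ^ (m + 1) := by
    intro m n hmn
    -- Change the basic element at the coarse precision `m` first, then the precision at the fixed
    -- element `i n`.
    calc dist (w m) (w n) ≤ dist (w m) (u (v (halfPowCode (m + 2)) (i n)))
          + dist (u (v (halfPowCode (m + 2)) (i n))) (w n) := dist_triangle _ _ _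
      _ ≤ (1 / 2) ^ (m + 2) + (1 / 2) ^ (m + 2) :=
        add_le_add (hmod' m _ _ (hir m) (hir n) (hize m m le_rfl) (hize n m hmn)).le
          (hlim' m n _ hmn (hir n)).le
      _ = _ := half_pow_add_half_pow _
  have hzero : Filter.Tendsto (fun m : ℕ => (1 / 2 : ℝ) ^ m) Filter.atTop (nhds 0) :=
    tendsto_pow_atTop_nhds_zero_of_lt_one (by norm_num) (by norm_num)
  have hcauchy : CauchySeq w :=
    cauchySeq_of_le_tendsto_0' _ hstep (hzero.comp (Filter.tendsto_add_atTop_nat 1))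
  obtain ⟨y, hy⟩ := cauchySeq_tendsto_of_complete hcauchy
  have hwy : ∀ m, dist (w m) y ≤ (1 / 2) ^ (m + 1) := fun m =>
    le_of_tendsto (tendsto_const_nhds.dist hy)
      (Filter.eventually_atTop.2 ⟨m, fun n hn => hstep m n hn⟩)
  refine ⟨y, ?_, fun e j hj hzj => ?_⟩
  -- The exact preimages `y' m` of `u (i m)` have the same limit as `w`, so continuity of the digit
  -- gives `D d y = z`.
  · choose y' hDy' hy' using fun m => hinv (halfPowCode (m + 2)) (i m) (hir m)
    have h1 : Filter.Tendsto y' Filter.atTop (nhds y) := by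
      refine (tendsto_iff_of_dist (squeeze_zero (fun _ => dist_nonneg) (fun m => ?_)
        (hzero.comp (Filter.tendsto_add_atTop_nat 2)))).2 hy
      exact ((hy' m).trans_eq (posRatOfCode_halfPowCode _)).le
    have h2 : Filter.Tendsto (fun m => u (i m)) Filter.atTop (nhds z) := by
      rw [tendsto_iff_dist_tendsto_zero]
      exact squeeze_zero (fun _ => dist_nonneg)
        (fun m => (dist_comm _ _).trans_le (hizm m).le) hzero
    have h3 := ((hX.digitSpace.continuous d).tendsto y).comp h1
    exact tendsto_nhds_unique h3 (h2.congr fun m => (hDy' m).symm)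
  · calc dist y (u (v (halfPowCode (e + 2)) j))
        ≤ dist (w e) y + dist (w e) (u (v (halfPowCode (e + 2)) j)) := dist_triangle_left _ _ _
      _ < (1 / 2) ^ (e + 1) + (1 / 2) ^ (e + 1) := by
          refine add_lt_add_of_le_of_lt (hwy e) ?_
          exact (hmod' e _ _ (hir e) hj (hize e e le_rfl) hzj).trans
            (pow_lt_pow_right_of_lt_one₀ (by norm_num) (by norm_num) (by omega))
      _ = _ := half_pow_add_half_pow _

/-- Computable selection of preimages: `s d` is a right inverse of `d` on the interior of `d[X]`,
and `V` computes basic elements approximating its values. -/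
theorem exists_computable_selection (hX : IsComputableDigitSpace D u) (hdec : IsDecidable D u)
    (hchoice : HasApproximableChoice D u) :
    ∃ (s : Fin k → X → X) (V : Fin k × (ℕ × ℕ) × ℕ × ℕ → ℕ) (H : ℕ → ℕ),
      Computable V ∧ Computable H ∧ (∀ n, n ≤ H n) ∧
      ∀ d, ∀ z ∈ interior (range (D d)), D d (s d z) = z ∧
        ∀ c e i, Metric.ball (u i) (posRatOfCode c : ℝ) ⊆ range (D d) →
          dist z (u i) < (1 / 2) ^ H e → dist (s d z) (u (V (d, c, e, i))) < (1 / 2) ^ e := by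
  choose v hpart hlim hmod hinv using hchoice
  choose f hf hvf using hpart
  choose g hg hmod using hmod
  choose s hDs hs using fun d z (hz : z ∈ interior (range (D d))) =>
    exists_right_inverse hX (hlim d) (hmod d) (hinv d) hz
  obtain ⟨_, hchk⟩ := hdec
  obtain ⟨H, hH, hnH, hgH⟩ := exists_computable_max
    (f := fun d e => (g d (halfPowCode (e + 2))).2 + 1) fun d =>
      Computable.succ.comp (Computable.snd.comp ((hg d).comp (computable_halfPowCode.comp
        (Computable.succ.comp Computable.succ))))
  classical
  -- Off the interior the value of `s` is arbitrary. The choice procedure may diverge off `d[X]`, so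
  -- it runs only after the ball check has placed `u i` in `d[X]`; otherwise `V` returns the default
  -- `0`.
  refine ⟨fun d z => if hz : z ∈ interior (range (D d)) then s d z hz else z,
    fun p => cond (decide (Metric.ball (u p.2.2.2) (posRatOfCode p.2.1 : ℝ) ⊆ range (D p.1)))
      (v p.1 (halfPowCode (p.2.2.1 + 2)) p.2.2.2) 0, H, ?_, hH, hnH, fun d z hz => ?_⟩
  · have hc : Computable fun p : Fin k × (ℕ × ℕ) × ℕ × ℕ =>
        decide (Metric.ball (u p.2.2.2) (posRatOfCode p.2.1 : ℝ) ⊆ range (D p.1)) :=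
      (hchk.comp (f := fun q : ℕ × (ℕ × ℕ) × Fin k => decide
          (Metric.ball (u q.1) (posRatOfCode q.2.1 : ℝ) ⊆ range (D q.2.2)))
        (g := fun p : Fin k × (ℕ × ℕ) × ℕ × ℕ => (p.2.2.2, p.2.1, p.1))
        (Computable.pair (Computable.snd.comp (Computable.snd.comp .snd))
          (Computable.pair (Computable.fst.comp .snd) .fst))).of_eq fun p => by
            congr
    have hF : Partrec fun p : Fin k × (ℕ × ℕ) × ℕ × ℕ =>
        f p.1 (halfPowCode (p.2.2.1 + 2), p.2.2.2) :=
      (partrec_of_fin hf).comp (Computable.pair .fst (Computable.pair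
        (computable_halfPowCode.comp (Computable.succ.comp (Computable.succ.comp
          (Computable.fst.comp (Computable.snd.comp .snd)))))
        (Computable.snd.comp (Computable.snd.comp .snd))))
    refine (Partrec.cond hc hF (Computable.const 0)).of_eq_tot fun p => ?_
    by_cases hp : Metric.ball (u p.2.2.2) (posRatOfCode p.2.1 : ℝ) ⊆ range (D p.1)
    · simp only [hp, decide_true, cond_true]
      exact hvf p.1 _ _ (hp (Metric.mem_ball_self (by exact_mod_cast posRatOfCode_pos _)))
    · simp [hp]
  · simp only [hz, dif_pos]
    refine ⟨hDs d z hz, fun c e i hball hzi => ?_⟩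
    simp only [hball, decide_true, cond_true]
    refine hs d z hz e i (hball (Metric.mem_ball_self (by exact_mod_cast posRatOfCode_pos _)))
      (hzi.trans_le ?_)
    exact pow_le_pow_of_le_one (by norm_num) (by norm_num) (hgH d e)

end

/-! ### Trees cut out by a decidable test -/

/-- The fold carries the prefix read so far together with the conjunction of the tests on it and all
shorter prefixes. -/
theorem computablePred_forall_prefix {α : Type*} [Primcodable α] {P : List α → Bool}
    (hP : Computable P) : ComputablePred fun l => ∀ l', l' <+: l → P l' = true := by
  classical
  refine ComputablePred.computable_iff.2 ⟨fun l => (l.foldl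
    (fun (s : List α × Bool) d => (s.1 ++ [d], s.2 && P (s.1 ++ [d]))) ([], P [])).2, ?_, ?_⟩
  · refine Computable.snd.comp (computable_list_foldl
      (h := fun _ (s : List α × Bool) d => (s.1 ++ [d], s.2 && P (s.1 ++ [d])))
      Computable.id (Computable.const _) ?_)
    have h1 : Computable fun p : List α × (List α × Bool) × α => p.2.1.1 ++ [p.2.2] :=
      Computable.list_concat.comp (Computable.fst.comp (Computable.fst.comp .snd))
        (Computable.snd.comp .snd)
    exact Computable.pair h1 (Primrec.and.to_comp.comp
      (Computable.snd.comp (Computable.fst.comp .snd)) (hP.comp h1))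
  · funext l
    have key : (l.foldl (fun (s : List α × Bool) d => (s.1 ++ [d], s.2 && P (s.1 ++ [d])))
        ([], P [])) = (l, decide (∀ l', l' <+: l → P l' = true)) := by
      induction l using List.reverseRecOn with
      | nil => simp
      | append_singleton l d ih =>
        rw [List.foldl_append, ih]
        simp only [List.foldl_cons, List.foldl_nil, Prod.mk.injEq, true_and]
        rw [Bool.eq_iff_iff]
        simp only [Bool.and_eq_true, decide_eq_true_eq, List.prefix_concat_iff]
        constructor
        · rintro ⟨h1, h2⟩ l' (rfl | h)
          exacts [h2, h1 _ h]
        · exact fun h => ⟨fun l' hl' => h l' (Or.inr hl'), h _ (Or.inl rfl)⟩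
    simp [key]

/-! ### Expansions of points -/

section Expansion

variable {X : Type*} [MetricSpace X] {k : ℕ}

/-- `IsExpansion D s r l z`: the word `l` is an initial part of an expansion of the point `z`
produced by the selections `s`, and at each stage the ball of radius `r` about the current point
is contained in the range of the next digit. -/
def IsExpansion (D s : Fin k → X → X) (r : ℝ) : List (Fin k) → X → Prop
  | [], _ => True
  | d :: l, z => Metric.ball z r ⊆ range (D d) ∧ IsExpansion D s r l (s d z)

variable {D s : Fin k → X → X}

theorem IsExpansion.mono {r r' : ℝ} (h : r' ≤ r) {l : List (Fin k)} {z : X}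
    (hl : IsExpansion D s r l z) : IsExpansion D s r' l z := by
  induction l generalizing z with
  | nil => trivial
  | cons d l ih => exact ⟨(Metric.ball_subset_ball h).trans hl.1, ih hl.2⟩

theorem IsExpansion.of_append {r : ℝ} {l l' : List (Fin k)} {z : X}
    (h : IsExpansion D s r (l ++ l') z) : IsExpansion D s r l z := by
  induction l generalizing z with
  | nil => trivial
  | cons d l ih => exact ⟨h.1, ih h.2⟩

theorem IsExpansion.exists_append_singleton {r : ℝ}
    (hr : ∀ x, ∃ d, Metric.ball x r ⊆ range (D d)) {l : List (Fin k)} {z : X}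
    (h : IsExpansion D s r l z) : ∃ d, IsExpansion D s r (l ++ [d]) z := by
  induction l generalizing z with
  | nil => exact (hr z).imp fun d hd => ⟨hd, trivial⟩
  | cons d l ih => exact (ih h.2).imp fun d' hd' => ⟨h.1, hd'⟩

theorem exists_isExpansion {r : ℝ} (hr : ∀ x, ∃ d, Metric.ball x r ⊆ range (D d)) (n : ℕ)
    (z : X) : ∃ l, l.length = n ∧ IsExpansion D s r l z := by
  induction n with
  | zero => exact ⟨[], rfl, trivial⟩
  | succ n ih =>
    obtain ⟨l, rfl, hl⟩ := ih
    obtain ⟨d, hd⟩ := hl.exists_append_singleton hr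
    exact ⟨l ++ [d], by simp, hd⟩

theorem mem_interior_of_ball_subset {t : Set X} {z : X} {r : ℝ} (hr : 0 < r)
    (h : Metric.ball z r ⊆ t) : z ∈ interior t :=
  mem_interior.2 ⟨_, h, Metric.isOpen_ball, Metric.mem_ball_self hr⟩

/-- Since `s d` inverts `d` on the right, the digits read off lead back from the final point to `z`.
-/
theorem IsExpansion.mem_range {r : ℝ} (hr : 0 < r)
    (hs : ∀ d, ∀ z ∈ interior (range (D d)), D d (s d z) = z) {l : List (Fin k)} {z : X}
    (h : IsExpansion D s r l z) : z ∈ range (comp D l) := by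
  induction l generalizing z with
  | nil => exact ⟨z, rfl⟩
  | cons d l ih =>
    obtain ⟨x, hx⟩ := ih h.2
    refine ⟨x, ?_⟩
    rw [← hs d z (mem_interior_of_ball_subset hr h.1), ← hx]
    rfl

/-- The approximate version of `IsExpansion`, on indices of basic elements. -/
def isExpansionTest (chk : ℕ × (ℕ × ℕ) × Fin k → Bool) (V : Fin k × (ℕ × ℕ) × ℕ × ℕ → ℕ)
    (H : ℕ → ℕ) (c : ℕ × ℕ) (e : ℕ) : List (Fin k) → ℕ → Bool
  | [], _ => true
  | d :: l, i => chk (i, c, d) && isExpansionTest chk V H c e l (V (d, c, H^[l.length] e, i))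

theorem computable_isExpansionTest {chk : ℕ × (ℕ × ℕ) × Fin k → Bool}
    {V : Fin k × (ℕ × ℕ) × ℕ × ℕ → ℕ} {H : ℕ → ℕ} (hchk : Computable chk) (hV : Computable V)
    (hH : Computable H) :
    Computable fun p : (ℕ × ℕ) × ℕ × List (Fin k) × ℕ =>
      isExpansionTest chk V H p.1 p.2.1 p.2.2.1 p.2.2.2 := by
  -- The state holds the verdict, the current index and the number of letters left, which fixes the
  -- precision still needed.
  let step : (ℕ × ℕ) × ℕ → Bool × ℕ × ℕ → Fin k → Bool × ℕ × ℕ := fun p t d =>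
    (t.1 && chk (t.2.1, p.1, d), V (d, p.1, H^[t.2.2.pred] p.2, t.2.1), t.2.2.pred)
  have key : ∀ (c : ℕ × ℕ) (e : ℕ) (l : List (Fin k)) (i : ℕ) (b : Bool),
      (l.foldl (step (c, e)) (b, i, l.length)).1 = (b && isExpansionTest chk V H c e l i) := by
    intro c e l
    induction l with
    | nil => simp [isExpansionTest]
    | cons d l ih =>
      intro i b
      simp only [List.foldl_cons, step, List.length_cons, Nat.pred_succ] at ih ⊢
      rw [ih, isExpansionTest, Bool.and_assoc]
  refine (Computable.fst.comp (computable_list_foldl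
    (f := fun p : (ℕ × ℕ) × ℕ × List (Fin k) × ℕ => p.2.2.1)
    (g := fun p => (true, p.2.2.2, p.2.2.1.length))
    (h := fun p => step (p.1, p.2.1)) ?_ ?_ ?_)).of_eq fun p => ?_
  · exact Computable.fst.comp (Computable.snd.comp .snd)
  · exact Computable.pair (Computable.const _) (Computable.pair
      (Computable.snd.comp (Computable.snd.comp .snd))
      (Computable.list_length.comp (Computable.fst.comp (Computable.snd.comp .snd))))
  · have hc : Computable fun p : ((ℕ × ℕ) × ℕ × List (Fin k) × ℕ) × (Bool × ℕ × ℕ) × Fin k =>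
        p.1.1 := Computable.fst.comp .fst
    have he : Computable fun p : ((ℕ × ℕ) × ℕ × List (Fin k) × ℕ) × (Bool × ℕ × ℕ) × Fin k =>
        p.1.2.1 := Computable.fst.comp (Computable.snd.comp .fst)
    have ht : Computable fun p : ((ℕ × ℕ) × ℕ × List (Fin k) × ℕ) × (Bool × ℕ × ℕ) × Fin k =>
        p.2.1 := Computable.fst.comp .snd
    have hd : Computable fun p : ((ℕ × ℕ) × ℕ × List (Fin k) × ℕ) × (Bool × ℕ × ℕ) × Fin k =>
        p.2.2 := Computable.snd.comp .snd
    have hi := Computable.fst.comp (Computable.snd.comp ht)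
    have hn := Computable.pred.comp (Computable.snd.comp (Computable.snd.comp ht))
    exact Computable.pair
      (Primrec.and.to_comp.comp (Computable.fst.comp ht)
        (hchk.comp (Computable.pair hi (Computable.pair hc hd))))
      (Computable.pair (hV.comp (Computable.pair hd (Computable.pair hc
        (Computable.pair ((computable_iterate hH).comp hn he) hi)))) hn)
  · simp [key]

variable {u : ℕ → X} {V : Fin k × (ℕ × ℕ) × ℕ × ℕ → ℕ} {H : ℕ → ℕ}
  {chk : ℕ × (ℕ × ℕ) × Fin k → Bool}

theorem half_pow_iterate_le (hH : ∀ n, n ≤ H n) (n e : ℕ) :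
    (1 / 2 : ℝ) ^ H^[n] e ≤ (1 / 2 : ℝ) ^ e := by
  refine pow_le_pow_of_le_one (by norm_num) (by norm_num) ?_
  induction n with
  | zero => rfl
  | succ n ih => rw [Function.iterate_succ_apply']; exact ih.trans (hH _)

/-- Each selection costs one application of `H` in precision, so starting from `H^[l.length] e` the
error stays below `2⁻ᵉ` at every letter. Moving the centre of a ball from `z` to `u i` therefore
costs at most `2⁻ᵉ` in radius. The next lemma moves it back at the same cost. -/
theorem isExpansionTest_of_isExpansion
    (hchk : ∀ i c d, chk (i, c, d) = true ↔
      Metric.ball (u i) (posRatOfCode c : ℝ) ⊆ range (D d))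
    (hH : ∀ n, n ≤ H n)
    (hV : ∀ d, ∀ z ∈ interior (range (D d)), ∀ c e i,
      Metric.ball (u i) (posRatOfCode c : ℝ) ⊆ range (D d) → dist z (u i) < (1 / 2) ^ H e →
      dist (s d z) (u (V (d, c, e, i))) < (1 / 2) ^ e)
    {r : ℝ} {c : ℕ × ℕ} {e : ℕ} (hr : 0 < r) (hrc : posRatOfCode c + (1 / 2 : ℝ) ^ e ≤ r)
    {l : List (Fin k)} {z : X} {i : ℕ} (hl : IsExpansion D s r l z)
    (hzi : dist z (u i) < (1 / 2) ^ H^[l.length] e) :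
    isExpansionTest chk V H c e l i = true := by
  induction l generalizing z i with
  | nil => rfl
  | cons d l ih =>
    have hball : Metric.ball (u i) (posRatOfCode c : ℝ) ⊆ range (D d) := by
      refine (Metric.ball_subset_ball' ?_).trans hl.1
      rw [dist_comm]
      linarith [half_pow_iterate_le hH (d :: l).length e]
    rw [isExpansionTest, Bool.and_eq_true, hchk]
    refine ⟨hball, ih hl.2 (hV d z (mem_interior_of_ball_subset hr hl.1) c _ i hball ?_)⟩
    rwa [List.length_cons, Function.iterate_succ_apply'] at hzi

theorem isExpansion_of_isExpansionTest
    (hchk : ∀ i c d, chk (i, c, d) = true ↔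
      Metric.ball (u i) (posRatOfCode c : ℝ) ⊆ range (D d))
    (hH : ∀ n, n ≤ H n)
    (hV : ∀ d, ∀ z ∈ interior (range (D d)), ∀ c e i,
      Metric.ball (u i) (posRatOfCode c : ℝ) ⊆ range (D d) → dist z (u i) < (1 / 2) ^ H e →
      dist (s d z) (u (V (d, c, e, i))) < (1 / 2) ^ e)
    {r : ℝ} {c : ℕ × ℕ} {e : ℕ} (hr : 0 < r) (hrc : r + (1 / 2 : ℝ) ^ e ≤ posRatOfCode c)
    {l : List (Fin k)} {z : X} {i : ℕ} (hl : isExpansionTest chk V H c e l i = true)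
    (hzi : dist z (u i) < (1 / 2) ^ H^[l.length] e) : IsExpansion D s r l z := by
  induction l generalizing z i with
  | nil => trivial
  | cons d l ih =>
    rw [isExpansionTest, Bool.and_eq_true, hchk] at hl
    have hball : Metric.ball z r ⊆ range (D d) := by
      refine (Metric.ball_subset_ball' ?_).trans hl.1
      linarith [half_pow_iterate_le hH (d :: l).length e]
    refine ⟨hball, ih hl.2 (hV d z (mem_interior_of_ball_subset hr hball) c _ i hl.1 ?_)⟩
    rwa [List.length_cons, Function.iterate_succ_apply'] at hzi

end Expansion

/-! ### Computable compact sets are values of computable trees -/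

section Tree

variable {X : Type*} [MetricSpace X] {k : ℕ} {D s : Fin k → X → X}

/-- A decidable test on words which, at every length `n`, lies between having an expansion in `K`
with radius `a n` and having one with radius `a (n + 1)` gives a tree with value `K`. -/
theorem mem_computableCompacts_of_test (hD : IsDigitSpace D)
    (hs : ∀ d, ∀ z ∈ interior (range (D d)), D d (s d z) = z) {a : ℕ → ℝ} (ha : Antitone a)
    (hpos : ∀ n, 0 < a n) (hcover : ∀ x, ∃ d, Metric.ball x (a 0) ⊆ range (D d))
    {P : List (Fin k) → Bool} (hP : Computable P) {K : NonemptyCompacts X}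
    (hP₁ : ∀ l, ∀ x ∈ (K : Set X), IsExpansion D s (a l.length) l x → P l = true)
    (hP₂ : ∀ l, P l = true → ∃ x ∈ (K : Set X), IsExpansion D s (a (l.length + 1)) l x) :
    K ∈ computableCompacts D := by
  have hcover' : ∀ n x, ∃ d, Metric.ball x (a n) ⊆ range (D d) := fun n x =>
    (hcover x).imp fun d hd => (Metric.ball_subset_ball (ha n.zero_le)).trans hd
  -- `P` itself need not be closed under prefixes, hence the quantifier.
  refine ⟨{l | ∀ l', l' <+: l → P l' = true}, ⟨?_, ?_, ?_⟩, computablePred_forall_prefix hP, ?_⟩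
  · obtain ⟨x, hx⟩ := K.nonempty
    intro l' hl'
    rw [List.prefix_nil.1 hl']
    exact hP₁ [] x hx trivial
  · exact fun l d h l' hl' => h l' (hl'.trans (List.prefix_append _ _))
  · intro l hl
    obtain ⟨x, hx, hlx⟩ := hP₂ l (hl l List.prefix_rfl)
    obtain ⟨d, hd⟩ := hlx.exists_append_singleton (hcover' _)
    -- The radius `a (l.length + 1)` supplied by `hP₂` is exactly the one `hP₁` needs for the longer
    -- word.
    refine ⟨d, fun l' hl' => ?_⟩
    rcases List.prefix_concat_iff.1 hl' with rfl | h
    · exact hP₁ _ x hx (by simpa using hd)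
    · exact hl l' h
  · ext y
    rw [mem_treeValue]
    constructor
    · intro hy
      obtain ⟨c, b, hcb⟩ := hD.exists_rate
      rw [← K.isCompact.isClosed.closure_eq, Metric.mem_closure_iff]
      intro ε hε
      obtain ⟨n, hn⟩ := exists_pow_lt_of_lt_one hε (show (1 / 2 : ℝ) < 1 by norm_num)
      obtain ⟨l, hl, hlen, z, rfl⟩ := hy (c * (n + b))
      obtain ⟨x, hx, hlx⟩ := hP₂ l (hl l List.prefix_rfl)
      obtain ⟨z', rfl⟩ := hlx.mem_range (hpos _) hs
      exact ⟨_, hx, (hcb l n z z' hlen.ge).trans_lt hn⟩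
    · intro hy n
      -- Expanding with the largest radius `a 0` makes prefixes of every length pass.
      obtain ⟨l, hl, hly⟩ := exists_isExpansion (s := s) hcover n y
      refine ⟨l, ?_, hl, hly.mem_range (hpos 0) hs⟩
      rintro l' ⟨l'', rfl⟩
      exact hP₁ l' y hy (hly.of_append.mono (ha l'.length.zero_le))

/-- The code of `2⁻ᴬ (1 + 2⁻ⁿ - 2⁻ⁿ⁻²)`. -/
def radiusCode (A n : ℕ) : ℕ × ℕ := (2 ^ (n + 2) + 2, 2 ^ (A + n + 2) - 1)

theorem posRatOfCode_radiusCode (A n : ℕ) : (posRatOfCode (radiusCode A n) : ℝ)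
    = (1 / 2) ^ A * (1 + (1 / 2) ^ n) - (1 / 2) ^ (A + n + 2) := by
  have h : ((2 ^ (A + n + 2) - 1 : ℕ) : ℝ) + 1 = 2 ^ (A + n + 2) := by
    have : 2 ^ (A + n + 2) - 1 + 1 = 2 ^ (A + n + 2) := Nat.sub_add_cancel Nat.one_le_two_pow
    exact_mod_cast this
  simp only [posRatOfCode, radiusCode]
  push_cast
  rw [h]
  simp only [one_div, inv_pow, pow_add]
  field_simp
  ring

theorem computable_radiusCode (A : ℕ) : Computable (radiusCode A) := by
  have hadd : ∀ m, Computable fun n : ℕ => n + m := fun m =>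
    (Primrec.nat_add.comp Primrec.id (Primrec.const m)).to_comp
  refine Computable.pair ((hadd 2).comp (computable_pow_two.comp (hadd 2))) ?_
  refine Primrec.nat_sub.to_comp.comp (computable_pow_two.comp ?_) (Computable.const 1)
  exact ((hadd (A + 2))).of_eq fun n => by omega

variable {u : ℕ → X}

theorem tteComputableCompacts_subset (hX : IsComputableDigitSpace D u) (hwell : IsWellCovering D)
    (hdec : IsDecidable D u) (hchoice : HasApproximableChoice D u) :
    tteComputableCompacts u ⊆ computableCompacts D := by
  rintro K ⟨U, hU, hKU⟩
  have hD := hX.digitSpace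
  have := hD.compactSpace
  obtain ⟨s, V, H, hV, hH, hnH, hsV⟩ := exists_computable_selection hX hdec hchoice
  have hs := fun d z hz => (hsV d z hz).1
  have hVs := fun d z hz => (hsV d z hz).2
  obtain ⟨chk, hchk, hchkD⟩ := ComputablePred.computable_iff.1 hdec
  have hchkD' : ∀ i c d, chk (i, c, d) = true ↔
      Metric.ball (u i) (posRatOfCode c : ℝ) ⊆ range (D d) := fun i c d =>
    (Iff.of_eq (congrFun hchkD (i, c, d))).symm
  obtain ⟨δ, hδ, hball⟩ := lebesgue_number_lemma_of_metric (isCompact_univ (X := X))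
    (fun d : Fin k => isOpen_interior (s := range (D d))) fun x _ => mem_iUnion.2 (hwell x)
  -- Half the Lebesgue number, because the largest radius `a 0` is twice `2⁻ᴬ`.
  obtain ⟨A, hA⟩ := exists_pow_lt_of_lt_one (half_pos hδ) (show (1 / 2 : ℝ) < 1 by norm_num)
  set a : ℕ → ℝ := fun n => (1 / 2) ^ A * (1 + (1 / 2) ^ n) with ha
  have ha_pos : ∀ n, 0 < a n := fun n => by positivity
  -- The coded radius is the midpoint of `a (n + 1)` and `a n`, at distance exactly `2⁻⁽ᴬ⁺ⁿ⁺²⁾` from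
  -- both; this is the error that the test tolerates.
  have hupper : ∀ n, posRatOfCode (radiusCode A n) + (1 / 2 : ℝ) ^ (A + n + 2) ≤ a n := fun n => by
    rw [posRatOfCode_radiusCode]; simp [ha]
  have hlower : ∀ n, a (n + 1) + (1 / 2 : ℝ) ^ (A + n + 2) ≤ posRatOfCode (radiusCode A n) :=
    fun n => by rw [posRatOfCode_radiusCode]; simp only [ha, pow_add]; linarith
  have happrox : ∀ n, (∀ x ∈ (K : Set X), ∃ i ∈ U n, dist x (u i) < (1 / 2) ^ n) ∧
      ∀ i ∈ U n, ∃ x ∈ (K : Set X), dist x (u i) < (1 / 2) ^ n := by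
    intro n
    obtain ⟨hne, hdist⟩ := hKU n
    obtain ⟨i₀, hi₀⟩ := List.exists_mem_of_ne_nil _ hne
    have htop := Metric.hausdorffEDist_ne_top_of_nonempty_of_bounded K.nonempty
      ⟨u i₀, mem_image_of_mem u hi₀⟩ K.isCompact.isBounded
      (((U n).finite_toSet).image u).isBounded
    constructor
    · intro x hx
      obtain ⟨_, ⟨i, hi, rfl⟩, h⟩ := Metric.exists_dist_lt_of_hausdorffDist_lt hx hdist htop
      exact ⟨i, hi, h⟩
    · intro i hi
      exact Metric.exists_dist_lt_of_hausdorffDist_lt' (mem_image_of_mem u hi) hdist htop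
  have hprec : Computable fun l : List (Fin k) => A + l.length + 2 :=
    (Primrec.nat_add.comp (Primrec.nat_add.comp (Primrec.const A) Primrec.list_length)
      (Primrec.const 2)).to_comp
  -- `U` is queried at the precision that `l.length` successive selections demand, and a word passes
  -- if one of the listed elements passes the approximate test.
  refine mem_computableCompacts_of_test hD hs (a := a)
    (P := fun l => (U (H^[l.length] (A + l.length + 2))).any
      (isExpansionTest chk V H (radiusCode A l.length) (A + l.length + 2) l))
    (antitone_nat_of_succ_le fun n => ?_) ha_pos (fun x => ?_) ?_ (fun l x hx hl => ?_)
    (fun l hl => ?_)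
  · linarith [hlower n, hupper n, pow_pos (one_half_pos (α := ℝ)) (A + n + 2)]
  · refine (hball x trivial).imp fun d hd => ?_
    refine (Metric.ball_subset_ball ?_).trans (hd.trans interior_subset)
    simp only [ha, pow_zero]
    linarith
  · refine computable_list_any (hU.comp
      ((computable_iterate hH).comp Computable.list_length hprec)) ?_
    exact (computable_isExpansionTest hchk hV hH).comp (Computable.pair
      ((computable_radiusCode A).comp (Computable.list_length.comp .fst))
      (Computable.pair (hprec.comp .fst) Computable.id))
  · obtain ⟨i, hi, hxi⟩ := (happrox (H^[l.length] (A + l.length + 2))).1 x hx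
    exact List.any_eq_true.2 ⟨i, hi, isExpansionTest_of_isExpansion hchkD' hnH hVs (ha_pos _)
      (hupper _) hl hxi⟩
  · obtain ⟨i, hi, hil⟩ := List.any_eq_true.1 hl
    obtain ⟨x, hx, hxi⟩ := (happrox (H^[l.length] (A + l.length + 2))).2 i hi
    exact ⟨x, hx, isExpansion_of_isExpansionTest hchkD' hnH hVs (ha_pos _) (hlower _) hil hxi⟩

end Tree

end DigitSpaces

theorem mainTheorem11 {X : Type*} [MetricSpace X] {k : ℕ} (D : Fin k → X → X) (u : ℕ → X)
    (hX : DigitSpaces.IsComputableDigitSpace D u)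
    (hwell : DigitSpaces.IsWellCovering D)
    (hdec : DigitSpaces.IsDecidable D u)
    (hchoice : DigitSpaces.HasApproximableChoice D u) :
    DigitSpaces.computableCompacts D = DigitSpaces.tteComputableCompacts u :=
  Set.Subset.antisymm (DigitSpaces.computableCompacts_subset hX)
    (DigitSpaces.tteComputableCompacts_subset hX hwell hdec hchoice)
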